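/- A continuum is a compact connected metric space with more than one point. For a continuum $X$, let $C(X)$ be the set of all nonempty closed connected subsets of $X$, with the Hausdorff metric. For $p\in X$ let $C(p,X)=\{A\in C(X): p\in A\}$, and let $HS(p,X)=C(X)/C(p,X)$ be the quotient space of $C(X)$ obtained by collapsing $C(p,X)$ to a single point. A topological space $Y$ has property (b) if for every continuous map $f:Y\to S^1=\{z\in\mathbb{C}:|z|=1\}$ there is a continuous map $g:Y\to\mathbb{R}$ such that $f(y)=e^{i g(y)}$ for all $y\in Y$. **Theorem.** For every continuum $X$ and every $p\in X$, the space $HS(p,X)$ has property (b). -/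

import Mathlib

open TopologicalSpace

/-- The hyperspace `C(X)` of subcontinua of `X`: the nonempty compact (equivalently, when `X` is
compact metric, nonempty closed) connected subsets of `X`, one-point sets included.  As a subtype
of `NonemptyCompacts X` it carries the Hausdorff metric. -/
abbrev Subcontinua (X : Type*) [MetricSpace X] : Type _ :=
  {A : NonemptyCompacts X // IsConnected (A : Set X)}

/-- The subspace `C(p, X)` of `C(X)` formed by the subcontinua that contain `p`. -/
def subcontinuaThrough {X : Type*} [MetricSpace X] (p : X) : Set (Subcontinua X) :=
  {A | p ∈ A.1}

/-- For a subset `S` of `Z`, the equivalence relation on `Z` that identifies all points of `S`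
with each other and makes no other identification. -/
def collapseSetoid {Z : Type*} (S : Set Z) : Setoid Z where
  r a b := a = b ∨ (a ∈ S ∧ b ∈ S)
  iseqv :=
    { refl := fun _ => Or.inl rfl
      symm := by
        rintro a b (h | ⟨ha, hb⟩)
        · exact Or.inl h.symm
        · exact Or.inr ⟨hb, ha⟩
      trans := by
        rintro a b c (rfl | ⟨ha, hb⟩) (rfl | ⟨hb', hc⟩)
        · exact Or.inl rfl
        · exact Or.inr ⟨hb', hc⟩
        · exact Or.inr ⟨ha, hb⟩
        · exact Or.inr ⟨ha, hc⟩ }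

/-- The space `HS(p, X) = C(X) / C(p, X)`, with the quotient topology. -/
abbrev HS (X : Type*) [MetricSpace X] (p : X) : Type _ :=
  Quotient (collapseSetoid (subcontinuaThrough p))

/-- Property (b): every continuous `f : Y → S¹` is of the form `f y = exp (i g(y))` for some
continuous `g : Y → ℝ`. -/
def HasPropertyB (Y : Type*) [TopologicalSpace Y] : Prop :=
  ∀ f : C(Y, Circle), ∃ g : C(Y, ℝ), ∀ y : Y, f y = Circle.exp (g y)

/-! A map `f` on `C(X)` with constant value `z` on `C(p, X)` is lifted by winding along a discrete
path from each `A` to `X`. Iterated closed `ε`-thickenings of `A` reach `X` after finitely many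
steps; they may be disconnected but stay `ε`-chain connected, so for small `ε` each is replaced by a
nearby subcontinuum (`exists_subcontinuum_approximation`). Along this sequence `f` moves by less
than 1 per step and ends at `f X = z`. Subtracting the total angle from `arg z` gives the lift. It
is continuous because nearby sets have termwise close sequences, whose angles differ by a
telescoping sum of small squares (`totalAngle_add_circleAngle`). If `p ∈ A`, the replacements keep
`p`, so the sequence is constant; the lift is thus constant on `C(p, X)` and descends to the
quotient. -/

/-! ### Chain connected sets and their Hausdorff limits. -/

section ChainConnected

variable {X : Type*} [MetricSpace X]

/-- A set is `ε`-chain connected if it has no proper nonempty part that is closed under steps of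
length at most `ε` inside the set. -/
def ChainConnected (ε : ℝ) (B : Set X) : Prop :=
  ∀ T ⊆ B, T.Nonempty → (∀ x ∈ T, ∀ y ∈ B, dist x y ≤ ε → y ∈ T) → B ⊆ T

theorem ChainConnected.mono {ε δ : ℝ} {B : Set X} (h : ChainConnected ε B) (hεδ : ε ≤ δ) :
    ChainConnected δ B :=
  fun T hT hne hcl => h T hT hne fun x hx y hy hxy => hcl x hx y hy (hxy.trans hεδ)

/-- Otherwise the `ε`-balls about `T` and about `A \ T` cover `A`, and a point of `A` in both unions
joins `T` to `A \ T` in two steps. -/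
theorem IsPreconnected.chainConnected {A : Set X} (hA : IsPreconnected A) {ε : ℝ} (hε : 0 < ε) :
    ChainConnected ε A := by
  intro T hT hne hcl
  by_contra hsub
  obtain ⟨a, haA, haT⟩ := Set.not_subset.1 hsub
  obtain ⟨t, ht⟩ := hne
  have hcover : A ⊆ (⋃ x ∈ T, Metric.ball x ε) ∪ ⋃ x ∈ A \ T, Metric.ball x ε := by
    intro x hx
    by_cases hxT : x ∈ T
    · exact Or.inl (Set.mem_biUnion hxT (Metric.mem_ball_self hε))
    · exact Or.inr (Set.mem_biUnion (show x ∈ A \ T from ⟨hx, hxT⟩) (Metric.mem_ball_self hε))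
  obtain ⟨z, hzA, hz1, hz2⟩ := hA _ _ (isOpen_biUnion fun _ _ => Metric.isOpen_ball)
    (isOpen_biUnion fun _ _ => Metric.isOpen_ball) hcover
    ⟨t, hT ht, Set.mem_biUnion ht (Metric.mem_ball_self hε)⟩
    ⟨a, haA, Set.mem_biUnion (show a ∈ A \ T from ⟨haA, haT⟩) (Metric.mem_ball_self hε)⟩
  simp only [Set.mem_iUnion, Metric.mem_ball, exists_prop] at hz1 hz2
  obtain ⟨x, hx, hzx⟩ := hz1
  obtain ⟨y, ⟨hyA, hyT⟩, hzy⟩ := hz2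
  exact hyT (hcl z (hcl x hx z hzA (by rw [dist_comm]; exact hzx.le)) y hyA hzy.le)

theorem exists_dist_lt_of_dist_lt {A B : NonemptyCompacts X} {r : ℝ} (h : dist A B < r)
    {x : X} (hx : x ∈ A) : ∃ y ∈ B, dist x y < r := by
  rw [Metric.NonemptyCompacts.dist_eq] at h
  exact Metric.exists_dist_lt_of_hausdorffDist_lt hx h
    (Metric.hausdorffEDist_ne_top_of_nonempty_of_bounded A.nonempty B.nonempty
      A.isCompact.isBounded B.isCompact.isBounded)

/-- Hausdorff limits of increasingly finely chain connected sets are connected. -/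
theorem exists_not_chainConnected_of_not_isConnected {B : NonemptyCompacts X}
    (hB : ¬ IsConnected (B : Set X)) :
    ∃ ε > 0, ∀ B' : NonemptyCompacts X, dist B' B < ε → ¬ ChainConnected ε (B' : Set X) := by
  have hB' : ¬ IsPreconnected (B : Set X) := fun h => hB ⟨B.nonempty, h⟩
  rw [isPreconnected_closed_iff] at hB'
  push Not at hB'
  obtain ⟨t, t', ht, ht', hcover, ⟨u₀, hu₀B, hu₀⟩, ⟨v₀, hv₀B, hv₀⟩, hdisj⟩ := hB'
  have hd : Disjoint ((B : Set X) ∩ t) ((B : Set X) ∩ t') := by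
    rw [Set.disjoint_left]
    rintro x ⟨hxB, hxt⟩ ⟨-, hxt'⟩
    have : x ∈ (B : Set X) ∩ (t ∩ t') := ⟨hxB, hxt, hxt'⟩
    simp [hdisj] at this
  obtain ⟨r, hr, hgap⟩ := Metric.exists_pos_forall_lt_edist (B.isCompact.inter_right ht)
    (B.isCompact.isClosed.inter ht') hd
  have hgap' : ∀ x ∈ (B : Set X) ∩ t, ∀ y ∈ (B : Set X) ∩ t', (r : ℝ) < dist x y := by
    intro x hx y hy
    have := hgap x hx y hy
    rw [edist_nndist, ENNReal.coe_lt_coe] at this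
    exact_mod_cast this
  have hr' : (0 : ℝ) < r := by exact_mod_cast hr
  -- A step in `B'` from near `B ∩ t` to near `B ∩ t'` would bridge the gap `r` by three lengths of
  -- at most `r / 3`, two of them strictly less.
  refine ⟨r / 3, by positivity, fun B' hBB' hch => ?_⟩
  have hBB : dist B B' < r / 3 := by rwa [dist_comm]
  obtain ⟨b, hb, hub⟩ := exists_dist_lt_of_dist_lt hBB hu₀B
  obtain ⟨c, hc, hvc⟩ := exists_dist_lt_of_dist_lt hBB hv₀B
  have key := hch {x | x ∈ (B' : Set X) ∧ ∃ u ∈ (B : Set X) ∩ t, dist x u < r / 3}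
    (fun x hx => hx.1) ⟨b, hb, u₀, ⟨hu₀B, hu₀⟩, by rwa [dist_comm]⟩ ?_ hc
  · obtain ⟨-, u, hu, hcu⟩ := key
    have h1 := hgap' u hu v₀ ⟨hv₀B, hv₀⟩
    have h2 := dist_triangle u c v₀
    rw [dist_comm u c, dist_comm c v₀] at h2
    linarith
  · rintro x ⟨-, u, hu, hxu⟩ y hy hxy
    obtain ⟨w, hw, hyw⟩ := exists_dist_lt_of_dist_lt hBB' hy
    refine ⟨hy, w, ⟨hw, ?_⟩, hyw⟩
    rcases hcover hw with h | h
    · exact h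
    · exfalso
      have h1 := hgap' u hu w ⟨hw, h⟩
      have h2 := dist_triangle4 u x y w
      rw [dist_comm u x] at h2
      linarith

theorem isClosed_setOf_isConnected :
    IsClosed {A : NonemptyCompacts X | IsConnected (A : Set X)} := by
  rw [← isOpen_compl_iff, Metric.isOpen_iff]
  intro B hB
  obtain ⟨ε, hε, h⟩ := exists_not_chainConnected_of_not_isConnected hB
  exact ⟨ε, hε, fun B' hB' hconn => h B' hB' (hconn.isPreconnected.chainConnected hε)⟩

theorem isClosed_setOf_mem (p : X) : IsClosed {A : NonemptyCompacts X | p ∈ A} := by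
  rw [← isOpen_compl_iff, Metric.isOpen_iff]
  intro B hB
  obtain ⟨ε, hε, h⟩ := Metric.isOpen_iff.1 B.isCompact.isClosed.isOpen_compl p hB
  refine ⟨ε, hε, fun B' hB' hp => ?_⟩
  obtain ⟨y, hy, hpy⟩ := exists_dist_lt_of_dist_lt hB' hp
  exact h (show y ∈ Metric.ball p ε by rwa [Metric.mem_ball, dist_comm]) hy

variable [CompactSpace X]

/-- Within a closed family of compacta, sufficiently finely chain connected sets are close to
connected ones. -/
theorem exists_forall_chainConnected_exists_isConnected {S : Set (NonemptyCompacts X)}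
    (hS : IsClosed S) {η : ℝ} (hη : 0 < η) :
    ∃ ε > 0, ∀ B ∈ S, ChainConnected ε (B : Set X) →
      ∃ C ∈ S, IsConnected (C : Set X) ∧ dist B C < η := by
  set K : Set (NonemptyCompacts X) :=
    S \ Metric.thickening η {C | C ∈ S ∧ IsConnected (C : Set X)}
  -- Compactness turns the local bounds at non-connected sets into a single `ε`.
  have hKc : IsCompact K := (hS.sdiff Metric.isOpen_thickening).isCompact
  have hKn : ∀ B ∈ K, ¬ IsConnected (B : Set X) := fun B hB hconn =>
    hB.2 (Metric.self_subset_thickening hη _ ⟨hB.1, hconn⟩)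
  have hloc : ∃ ε > 0, ∀ B ∈ K, ¬ ChainConnected ε (B : Set X) := by
    refine hKc.induction_on (p := fun s => ∃ ε > 0, ∀ B ∈ s, ¬ ChainConnected ε (B : Set X))
      ⟨1, one_pos, by simp⟩ ?_ ?_ ?_
    · rintro s t hst ⟨ε, hε, h⟩
      exact ⟨ε, hε, fun B hB => h B (hst hB)⟩
    · rintro s t ⟨ε, hε, h⟩ ⟨δ, hδ, h'⟩
      refine ⟨min ε δ, lt_min hε hδ, ?_⟩
      rintro B (hB | hB) hch
      · exact h B hB (hch.mono (min_le_left _ _))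
      · exact h' B hB (hch.mono (min_le_right _ _))
    · intro B hB
      obtain ⟨ε, hε, h⟩ := exists_not_chainConnected_of_not_isConnected (hKn B hB)
      exact ⟨Metric.ball B ε, mem_nhdsWithin_of_mem_nhds (Metric.ball_mem_nhds B hε), ε, hε,
        fun B' hB' => h B' hB'⟩
  obtain ⟨ε, hε, h⟩ := hloc
  refine ⟨ε, hε, fun B hB hch => ?_⟩
  have hB' : B ∈ Metric.thickening η {C | C ∈ S ∧ IsConnected (C : Set X)} := by
    by_contra hcon
    exact h B ⟨hB, hcon⟩ hch
  obtain ⟨C, hC, hBC⟩ := Metric.mem_thickening_iff.1 hB'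
  exact ⟨C, hC.1, hC.2, hBC⟩

/-- A simultaneous choice of nearby subcontinua for finely chain connected sets, fixing the
subcontinua and preserving the condition of containing `p`. -/
theorem exists_subcontinuum_approximation [ConnectedSpace X] (p : X) {η : ℝ} (hη : 0 < η) :
    ∃ ε > 0, ∃ c : NonemptyCompacts X → Subcontinua X,
      (∀ B : NonemptyCompacts X, ChainConnected ε (B : Set X) → dist B (c B).1 < η) ∧
      (∀ B : NonemptyCompacts X, ChainConnected ε (B : Set X) → p ∈ B → p ∈ (c B).1) ∧
      ∀ A : Subcontinua X, c A.1 = A := by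
  obtain ⟨ε, hε, h⟩ := exists_forall_chainConnected_exists_isConnected (X := X) isClosed_univ hη
  obtain ⟨δ, hδ, h'⟩ := exists_forall_chainConnected_exists_isConnected (isClosed_setOf_mem p) hη
  have key : ∀ B : NonemptyCompacts X, ∃ C : Subcontinua X,
      (ChainConnected (min ε δ) (B : Set X) → dist B C.1 < η ∧ (p ∈ B → p ∈ C.1)) ∧
      (IsConnected (B : Set X) → C.1 = B) := by
    intro B
    by_cases hB : IsConnected (B : Set X)
    · exact ⟨⟨B, hB⟩, fun _ => ⟨by simpa using hη, id⟩, fun _ => rfl⟩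
    by_cases hch : ChainConnected (min ε δ) (B : Set X)
    · by_cases hp : p ∈ B
      · obtain ⟨C, hCp, hC, hBC⟩ := h' B hp (hch.mono (min_le_right _ _))
        exact ⟨⟨C, hC⟩, fun _ => ⟨hBC, fun _ => hCp⟩, fun h => absurd h hB⟩
      · obtain ⟨C, -, hC, hBC⟩ := h B trivial (hch.mono (min_le_left _ _))
        exact ⟨⟨C, hC⟩, fun _ => ⟨hBC, fun h => absurd h hp⟩, fun h => absurd h hB⟩
    -- A dummy value: both requirements are vacuous here.
    · exact ⟨⟨⟨⟨{p}, isCompact_singleton⟩, Set.singleton_nonempty p⟩, isConnected_singleton⟩,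
        fun h => absurd h hch, fun h => absurd h hB⟩
  choose c hc hc' using key
  exact ⟨min ε δ, lt_min hε hδ, c, fun B hB => (hc B hB).1, fun B hB => (hc B hB).2,
    fun A => Subtype.ext (hc' A.1 A.2)⟩

/-! ### Iterated thickenings. -/

/-- The closed `ε`-thickening of a compact set in a compact metric space. -/
def thickenCompacts (ε : ℝ) (B : NonemptyCompacts X) : NonemptyCompacts X where
  carrier := Metric.cthickening ε B
  isCompact' := Metric.isClosed_cthickening.isCompact
  nonempty' := B.nonempty.mono (Metric.self_subset_cthickening _)

theorem mem_thickenCompacts {ε : ℝ} (hε : 0 < ε) {B : NonemptyCompacts X} {x : X} :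
    x ∈ thickenCompacts ε B ↔ ∃ b ∈ B, dist x b ≤ ε := by
  change x ∈ Metric.cthickening ε (B : Set X) ↔ _
  rw [B.isCompact.cthickening_eq_biUnion_closedBall hε.le]
  simp

theorem le_thickenCompacts (ε : ℝ) (B : NonemptyCompacts X) {x : X} (hx : x ∈ B) :
    x ∈ thickenCompacts ε B :=
  Metric.self_subset_cthickening (B : Set X) hx

/-- Every point of the thickening is one step from `B`, so a step-closed part meets `B`, contains
it, and then contains everything. -/
theorem ChainConnected.thickenCompacts {ε : ℝ} (hε : 0 < ε) {B : NonemptyCompacts X}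
    (hB : ChainConnected ε (B : Set X)) :
    ChainConnected ε (thickenCompacts ε B : Set X) := by
  intro T hT ⟨x, hx⟩ hcl
  have hBT : (B : Set X) ⊆ T ∩ B := by
    refine hB _ Set.inter_subset_right ?_ ?_
    · obtain ⟨b, hb, hxb⟩ := (mem_thickenCompacts hε).1 (hT hx)
      exact ⟨b, hcl x hx b (le_thickenCompacts ε B hb) hxb, hb⟩
    · rintro y ⟨hyT, -⟩ z hz hyz
      exact ⟨hcl y hyT z (le_thickenCompacts ε B hz) hyz, hz⟩
  intro y hy
  obtain ⟨b, hb, hyb⟩ := (mem_thickenCompacts hε).1 hy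
  exact hcl b (hBT hb).1 y hy (by rwa [dist_comm])

theorem thickenCompacts_mono {ε : ℝ} {A B : NonemptyCompacts X} (h : (A : Set X) ⊆ B) :
    (thickenCompacts ε A : Set X) ⊆ thickenCompacts ε B :=
  Metric.cthickening_subset_of_subset ε h

theorem iterate_thickenCompacts_mono {ε : ℝ} {A B : NonemptyCompacts X} (h : (A : Set X) ⊆ B)
    (n : ℕ) : ((thickenCompacts ε)^[n] A : Set X) ⊆ (thickenCompacts ε)^[n] B := by
  induction n with
  | zero => exact h
  | succ n ih =>
    rw [Function.iterate_succ_apply', Function.iterate_succ_apply']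
    exact thickenCompacts_mono ih

theorem iterate_thickenCompacts_subset {ε : ℝ} (A : NonemptyCompacts X) {m n : ℕ} (h : m ≤ n) :
    ((thickenCompacts ε)^[m] A : Set X) ⊆ (thickenCompacts ε)^[n] A := by
  induction n, h using Nat.le_induction with
  | base => exact subset_rfl
  | succ n _ ih =>
    rw [Function.iterate_succ_apply']
    exact fun x hx => le_thickenCompacts ε _ (ih hx)

theorem dist_le_of_subset_thickenCompacts {ε : ℝ} (hε : 0 < ε) {A B : NonemptyCompacts X}
    (hAB : (A : Set X) ⊆ thickenCompacts ε B) (hBA : (B : Set X) ⊆ thickenCompacts ε A) :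
    dist A B ≤ ε := by
  rw [Metric.NonemptyCompacts.dist_eq]
  exact Metric.hausdorffDist_le_of_mem_dist hε.le
    (fun x hx => (mem_thickenCompacts hε).1 (hAB hx))
    (fun x hx => (mem_thickenCompacts hε).1 (hBA hx))

theorem dist_thickenCompacts_le {ε : ℝ} (hε : 0 < ε) (A : NonemptyCompacts X) :
    dist A (thickenCompacts ε A) ≤ ε :=
  dist_le_of_subset_thickenCompacts hε
    (fun _ hx => le_thickenCompacts ε _ (le_thickenCompacts ε _ hx)) subset_rfl

theorem dist_iterate_thickenCompacts_le {ε : ℝ} (hε : 0 < ε) {A B : NonemptyCompacts X}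
    (h : dist A B < ε) (n : ℕ) :
    dist ((thickenCompacts ε)^[n] A) ((thickenCompacts ε)^[n] B) ≤ ε := by
  have aux : ∀ {A B : NonemptyCompacts X}, dist A B < ε →
      ((thickenCompacts ε)^[n] A : Set X) ⊆ thickenCompacts ε ((thickenCompacts ε)^[n] B) := by
    intro A B h
    -- The extra thickening is moved innermost, where it absorbs the distance from `A` to `B`.
    rw [← Function.iterate_succ_apply' (thickenCompacts ε), Function.iterate_succ_apply]
    refine iterate_thickenCompacts_mono (fun x hx => ?_) n
    obtain ⟨y, hy, hxy⟩ := exists_dist_lt_of_dist_lt h hx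
    exact (mem_thickenCompacts hε).2 ⟨y, hy, hxy.le⟩
  exact dist_le_of_subset_thickenCompacts hε (aux h) (aux (by rwa [dist_comm]))

theorem ChainConnected.iterate_thickenCompacts {ε : ℝ} (hε : 0 < ε) {B : NonemptyCompacts X}
    (hB : ChainConnected ε (B : Set X)) (n : ℕ) :
    ChainConnected ε ((_root_.thickenCompacts ε)^[n] B : Set X) := by
  induction n with
  | zero => exact hB
  | succ n ih =>
    rw [Function.iterate_succ_apply']
    exact ih.thickenCompacts hε

/-- In a continuum, finitely many thickenings of a nonempty compact set exhaust the space. -/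
theorem exists_iterate_thickenCompacts_eq_top [ConnectedSpace X] {ε : ℝ} (hε : 0 < ε)
    (A : NonemptyCompacts X) : ∃ N, ∀ n ≥ N, (thickenCompacts ε)^[n] A = ⊤ := by
  have hall : ∀ x : X, ∃ n, x ∈ (thickenCompacts ε)^[n] A := by
    have := (isPreconnected_univ (α := X)).chainConnected hε
      {x | ∃ n, x ∈ (thickenCompacts ε)^[n] A} (Set.subset_univ _)
      (A.nonempty.mono fun x hx => ⟨0, hx⟩) ?_
    · exact fun x => this (Set.mem_univ x)
    · rintro x ⟨n, hn⟩ y - hxy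
      refine ⟨n + 1, ?_⟩
      rw [Function.iterate_succ_apply', mem_thickenCompacts hε]
      exact ⟨x, hn, by rwa [dist_comm]⟩
  choose k hk using hall
  obtain ⟨t, -, htf, hcover⟩ := (isCompact_univ (X := X)).finite_cover_balls hε
  obtain ⟨M, hM⟩ := (htf.image k).bddAbove
  -- By stage `M` a finite `ε`-net is covered; one more thickening covers the space.
  refine ⟨M + 1, fun n hn => ?_⟩
  refine SetLike.coe_injective ?_
  refine Set.eq_univ_of_forall fun x => iterate_thickenCompacts_subset A hn ?_
  obtain ⟨y, hy, hxy⟩ := Set.mem_iUnion₂.1 (hcover (Set.mem_univ x))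
  rw [Function.iterate_succ_apply']
  exact (mem_thickenCompacts hε).2
    ⟨y, iterate_thickenCompacts_subset A (hM ⟨y, hy, rfl⟩) (hk y), (Metric.mem_ball.1 hxy).le⟩

end ChainConnected

/-! ### Angles along discrete paths in the circle. -/

section Angle

/-- The angle in `(-π, π]` from `z` to `w`. -/
noncomputable def circleAngle (z w : Circle) : ℝ := Complex.arg (w / z : Circle)

theorem exp_circleAngle (z w : Circle) : Circle.exp (circleAngle z w) = w / z :=
  Circle.exp_arg _

theorem circleAngle_self (z : Circle) : circleAngle z z = 0 := by
  simp [circleAngle]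

theorem abs_circleAngle_lt {z w : Circle} (h : dist z w < 1) :
    |circleAngle z w| < Real.pi / 2 := by
  rw [circleAngle, Complex.abs_arg_lt_pi_div_two_iff]
  left
  have h1 : ‖((w / z : Circle) : ℂ) - 1‖ < 1 := by
    have : ((w / z : Circle) : ℂ) - 1 = ((w : ℂ) - z) / z := by
      rw [Circle.coe_div, sub_div, div_self z.coe_ne_zero]
    rw [this, norm_div, Circle.norm_coe, div_one, ← dist_eq_norm, dist_comm]
    exact h
  have h2 := (abs_lt.1 ((Complex.abs_re_le_norm _).trans_lt h1)).1
  rw [Complex.sub_re, Complex.one_re] at h2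
  linarith

/-- Angles add up in a small square. -/
theorem circleAngle_add_circleAngle {z w z' w' : Circle} (h1 : dist z w < 1) (h2 : dist w w' < 1)
    (h3 : dist z z' < 1) (h4 : dist z' w' < 1) :
    circleAngle z w + circleAngle w w' = circleAngle z z' + circleAngle z' w' := by
  have hexp : Circle.exp (circleAngle z w + circleAngle w w') =
      Circle.exp (circleAngle z z' + circleAngle z' w') := by
    simp only [Circle.exp_add, exp_circleAngle]
    rw [div_mul_div_cancel', div_mul_div_cancel']
  obtain ⟨m, hm⟩ := Circle.exp_eq_exp.1 hexp
  have a1 := abs_lt.1 (abs_circleAngle_lt h1)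
  have a2 := abs_lt.1 (abs_circleAngle_lt h2)
  have a3 := abs_lt.1 (abs_circleAngle_lt h3)
  have a4 := abs_lt.1 (abs_circleAngle_lt h4)
  have hpi := Real.pi_pos
  -- Four angles below `π / 2` in absolute value cannot differ by a nonzero multiple of `2π`.
  have hm0 : m = 0 := by
    have u : (m : ℝ) < 1 := by nlinarith
    have l : (-1 : ℝ) < m := by nlinarith
    have u' : m < 1 := by exact_mod_cast u
    have l' : -1 < m := by exact_mod_cast l
    omega
  simpa [hm0] using hm

theorem continuousAt_circleAngle {Y : Type*} [TopologicalSpace Y] {f : Y → Circle}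
    (hf : Continuous f) (y : Y) : ContinuousAt (fun x => circleAngle (f y) (f x)) y := by
  have h : Continuous fun x => ((f x / f y : Circle) : ℂ) := by fun_prop
  refine ContinuousAt.comp (f := fun x => ((f x / f y : Circle) : ℂ)) ?_ h.continuousAt
  refine Complex.continuousAt_arg ?_
  rw [div_self', Circle.coe_one]
  exact Complex.one_mem_slitPlane

/-- The total angle along the first `n` steps of a sequence of points of the circle. -/
noncomputable def totalAngle (s : ℕ → Circle) (n : ℕ) : ℝ :=
  ∑ k ∈ Finset.range n, circleAngle (s k) (s (k + 1))

theorem exp_totalAngle (s : ℕ → Circle) (n : ℕ) : Circle.exp (totalAngle s n) = s n / s 0 := by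
  induction n with
  | zero => simp [totalAngle]
  | succ n ih =>
    rw [totalAngle, Finset.sum_range_succ, Circle.exp_add, exp_circleAngle, ← totalAngle, ih,
      div_mul_div_cancel']

theorem totalAngle_add_circleAngle {s t : ℕ → Circle} (hs : ∀ k, dist (s k) (s (k + 1)) < 1)
    (ht : ∀ k, dist (t k) (t (k + 1)) < 1) (hst : ∀ k, dist (s k) (t k) < 1) (n : ℕ) :
    totalAngle s n + circleAngle (s n) (t n) = circleAngle (s 0) (t 0) + totalAngle t n := by
  induction n with
  | zero => simp [totalAngle]
  | succ n ih =>
    have h := circleAngle_add_circleAngle (hs n) (hst (n + 1)) (hst n) (ht n)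
    rw [totalAngle, totalAngle, Finset.sum_range_succ, Finset.sum_range_succ, ← totalAngle,
      ← totalAngle]
    linarith

theorem totalAngle_eq_of_eventually_const {s : ℕ → Circle} {z : Circle} {N n : ℕ}
    (h : ∀ k ≥ N, s k = z) (hn : N ≤ n) : totalAngle s n = totalAngle s N := by
  induction n, hn using Nat.le_induction with
  | base => rfl
  | succ n hn ih =>
    rw [totalAngle, Finset.sum_range_succ, ← totalAngle, ih, h n hn, h (n + 1) (by omega),
      circleAngle_self, add_zero]

end Angle

/-! ### Construction of the lift and descent to the quotient. -/

/-- A circle-valued map on `C(X)` that is constant on `C(p, X)` has a continuous logarithm that is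
constant on `C(p, X)`. -/
theorem exists_lift_constant_on_subcontinuaThrough {X : Type*} [MetricSpace X] [CompactSpace X]
    [ConnectedSpace X] (p : X) {f : Subcontinua X → Circle} (hf : Continuous f) {z : Circle}
    (hz : ∀ A ∈ subcontinuaThrough p, f A = z) :
    ∃ g : Subcontinua X → ℝ, Continuous g ∧ (∀ A, f A = Circle.exp (g A)) ∧
      ∀ A ∈ subcontinuaThrough p, g A = Complex.arg z := by
  have : CompactSpace (Subcontinua X) :=
    isCompact_iff_compactSpace.1 (isClosed_setOf_isConnected (X := X)).isCompact
  obtain ⟨δ, hδ, hfδ⟩ := Metric.uniformContinuous_iff.1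
    (CompactSpace.uniformContinuous_of_continuous hf) 1 one_pos
  obtain ⟨ε₀, hε₀, c, hc, hcp, hcA⟩ :=
    exists_subcontinuum_approximation p (show 0 < δ / 3 by positivity)
  -- Two approximation errors below `δ / 3` plus a step of at most `ε` stay below `δ`.
  obtain ⟨ε, hε, hεε₀, hεδ⟩ : ∃ ε > 0, ε ≤ ε₀ ∧ ε < δ / 3 :=
    ⟨min ε₀ (δ / 4), by positivity, min_le_left _ _, (min_le_right _ _).trans_lt (by linarith)⟩
  set s : Subcontinua X → ℕ → Circle := fun A n => f (c ((thickenCompacts ε)^[n] A.1)) with hs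
  have hch : ∀ (A : Subcontinua X) n,
      ChainConnected ε₀ ((thickenCompacts ε)^[n] A.1 : Set X) := fun A n =>
    ((A.2.isPreconnected.chainConnected hε).iterate_thickenCompacts hε n).mono hεε₀
  have hclose : ∀ B B' : NonemptyCompacts X, ChainConnected ε₀ (B : Set X) →
      ChainConnected ε₀ (B' : Set X) → dist B B' ≤ ε → dist (f (c B)) (f (c B')) < 1 := by
    intro B B' hB hB' hd
    refine hfδ (a := c B) (b := c B') ?_
    rw [Subtype.dist_eq]
    have h1 := dist_triangle4 (c B).1 B B' (c B').1
    have h2 := hc B hB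
    have h3 := hc B' hB'
    rw [dist_comm] at h2
    linarith
  have hs0 : ∀ A, s A 0 = f A := fun A => by simp [hs, hcA]
  have hstep : ∀ A k, dist (s A k) (s A (k + 1)) < 1 := fun A k =>
    hclose _ _ (hch A k) (hch A (k + 1)) (by
      rw [Function.iterate_succ_apply']; exact dist_thickenCompacts_le hε _)
  have htop : f (c ⊤) = z := by
    have hconn : IsConnected ((⊤ : NonemptyCompacts X) : Set X) := isConnected_univ
    rw [hcA ⟨⊤, hconn⟩]
    exact hz _ (Set.mem_univ p)
  choose N hN using fun A : Subcontinua X => exists_iterate_thickenCompacts_eq_top hε A.1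
  have hsN : ∀ A, ∀ k ≥ N A, s A k = z := fun A k hk => by
    rw [hs]
    simp only
    rw [hN A k hk, htop]
  have hdiff : ∀ A B, dist A B < ε →
      totalAngle (s A) (N A) = circleAngle (f A) (f B) + totalAngle (s B) (N B) := by
    intro A B hAB
    -- At a common index past both stopping times the closing angle is zero.
    have h := totalAngle_add_circleAngle (hstep A) (hstep B) (fun k =>
      hclose _ _ (hch A k) (hch B k) (dist_iterate_thickenCompacts_le hε hAB k)) (max (N A) (N B))
    rwa [totalAngle_eq_of_eventually_const (hsN A) (le_max_left _ _),
      totalAngle_eq_of_eventually_const (hsN B) (le_max_right _ _),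
      hsN A _ (le_max_left _ _), hsN B _ (le_max_right _ _), circleAngle_self, add_zero,
      hs0, hs0] at h
  refine ⟨fun A => Complex.arg z - totalAngle (s A) (N A), ?_, fun A => ?_, fun A hA => ?_⟩
  · rw [continuous_iff_continuousAt]
    intro A
    have h : ContinuousAt (fun B => Complex.arg z - totalAngle (s A) (N A) +
        circleAngle (f A) (f B)) A := continuousAt_const.add (continuousAt_circleAngle hf A)
    refine h.congr ?_
    filter_upwards [Metric.ball_mem_nhds A hε] with B hB
    rw [hdiff A B (by rwa [dist_comm])]
    ring
  · rw [Circle.exp_sub, Circle.exp_arg, exp_totalAngle, hsN A _ le_rfl, hs0, div_div_cancel]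
  · have hconst : ∀ k, s A k = z := fun k =>
      hz _ (hcp _ (hch A k) (iterate_thickenCompacts_subset A.1 (Nat.zero_le k) hA))
    simp [totalAngle, hconst, circleAngle_self]

theorem mainTheorem9 {X : Type*} [MetricSpace X] [CompactSpace X] [ConnectedSpace X]
    [Nontrivial X] (p : X) : HasPropertyB (HS X p) := by
  intro f
  let q : Subcontinua X → HS X p := Quotient.mk _
  let P : Subcontinua X :=
    ⟨⟨⟨{p}, isCompact_singleton⟩, Set.singleton_nonempty p⟩, isConnected_singleton⟩
  have hP : P ∈ subcontinuaThrough p := Set.mem_singleton p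
  obtain ⟨g, hg, hfg, hgp⟩ := exists_lift_constant_on_subcontinuaThrough p
    (f := f ∘ q) (f.continuous.comp continuous_quotient_mk') (z := f (q P))
    (fun A hA => congrArg f (Quotient.sound (Or.inr ⟨hA, hP⟩)))
  have hcompat : ∀ A B : Subcontinua X,
      (collapseSetoid (subcontinuaThrough p)).r A B → g A = g B := by
    rintro A B (rfl | ⟨hA, hB⟩)
    · rfl
    · rw [hgp A hA, hgp B hB]
  refine ⟨⟨Quotient.lift g hcompat, hg.quotient_lift hcompat⟩, fun y => ?_⟩
  induction y using Quotient.inductionOn with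
  | h A => exact hfg A
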